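/- Let $d\ge 0$ and $n\ge 1$ be integers, $R,B\in\mathbb{R}$ and $\rho\in[0,1)$. For $w\in\mathbb{R}^d$ let $h_w(x)=\operatorname{sgn}\langle w,x\rangle$ be the linear classifier without bias, where $\operatorname{sgn}(0)=0$ (so a point with $\langle w,x\rangle=0$ is never correctly classified). A vector $v$ is an *adversarial direction* for a classifier $h$ at $(x,y)$ if $h(x)=y$ and $h(x+cv)\ne y$ for some $c>0$. For a finite set $S\subset\mathbb{R}^d\times\{\pm1\}$, a *max-margin SVM* of $S$ (without bias) is a vector $w^*_S$ that maximizes the margin $\min_{(x,y)\in S}y\langle w,x\rangle$ among all $w\in\mathbb{R}^d$ with $\|w\|_2=1$ and $h_w(x)=y$ for all $(x,y)\in S$ (for $S=\emptyset$: any unit vector). Let $\mathcal{D}$ be a probability distribution on $\mathbb{R}^d\times\{\pm1\}$ such that $\|x\|_2\le R$ almost surely for $(x,y)\sim\mathcal{D}$. Let $S^{(1)},S^{(2)}$ be two samples, each consisting of $n$ i.i.d. draws $(x^{(j)}_i,y^{(j)}_i)$, $1\le i\le n$, from $\mathcal{D}$, and let $w^{(1)},w^{(2)}$ be random vectors in $\mathbb{R}^d$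 (the outputs of two, possibly randomized, training procedures on $S^{(1)}$ and $S^{(2)}$). Write $h_j=h_{w^{(j)}}$. Assume: 1. $\|w^{(j)}\|_2\le B$ almost surely, for $j\in\{1,2\}$; 2. the samples and training procedures are independent: the pairs $(S^{(1)},w^{(1)})$ and $(S^{(2)},w^{(2)})$ are independent; 3. almost surely, for each $j\in\{1,2\}$, at least $(1-\rho)n$ of the indices $i$ satisfy $y^{(j)}_i\langle w^{(j)},x^{(j)}_i\rangle\ge1$. Then, with probability at least $1-4n^{-2}$, there are a finite set $S$ of labelled points, each of which occurs in $S^{(1)}$ or $S^{(2)}$, and a max-margin SVM $w^*_S$ of $S$ such that for each $j\in\{1,2\}$: 1. $|S\cap S^{(j)}|\ge(1-2\rho)n-2BR\sqrt n-4\sqrt{n\ln n}$, where $|S\cap S^{(j)}|$ is the number of indices $i$ with $(x^{(j)}_i,y^{(j)}_i)\in S$ (counted with multiplicity); 2. for every $(x,y)\in S$, the vector $-y\,w^*_S$ is an adversarial direction for $h_j$ at $(x,y)$. -/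

import Mathlib

open MeasureTheory ProbabilityTheory

noncomputable section

namespace SoftMargin

/-- A labelled example `(x, y)`, with `x ∈ ℝᵈ` and a real label `y` (meant to be `1` or `-1`). -/
abbrev Example (d : ℕ) : Type := EuclideanSpace ℝ (Fin d) × ℝ

/-- The linear classifier without bias `x ↦ sgn ⟨w, x⟩`, where `sgn 0 = 0`; so a point on the
decision boundary is never correctly classified. -/
def linearClassifier {d : ℕ} (w x : EuclideanSpace ℝ (Fin d)) : ℝ :=
  Real.sign (inner ℝ w x)

/-- The classifier `h` is `S`-accurate: it gives every example of `S` its label. -/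
def Accurate {d : ℕ} (h : EuclideanSpace ℝ (Fin d) → ℝ) (S : Finset (Example d)) : Prop :=
  ∀ p ∈ S, h p.1 = p.2

/-- `v` is an adversarial direction for `h` at `(x, y)`. -/
def IsAdversarialDirection {d : ℕ} (h : EuclideanSpace ℝ (Fin d) → ℝ)
    (v x : EuclideanSpace ℝ (Fin d)) (y : ℝ) : Prop :=
  h x = y ∧ ∃ c : ℝ, 0 < c ∧ h (x + c • v) ≠ y

/-- The margin `min_{(x, y) ∈ S} y ⟨w, x⟩` of `w` on the finite set `S`. The infimum of a nonempty
finite family is its minimum; on the empty set all margins are `0`. -/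
def margin {d : ℕ} (S : Finset (Example d)) (w : EuclideanSpace ℝ (Fin d)) : ℝ :=
  ⨅ p : S, p.1.2 * inner ℝ w p.1.1

/-- `w` is the max-margin SVM (without bias) of `S`: among the unit vectors whose linear classifier
is `S`-accurate, it has the largest margin on `S`. -/
def IsMaxMarginSVM {d : ℕ} (S : Finset (Example d)) (w : EuclideanSpace ℝ (Fin d)) : Prop :=
  ‖w‖ = 1 ∧ Accurate (linearClassifier w) S ∧
    ∀ w' : EuclideanSpace ℝ (Fin d),
      ‖w'‖ = 1 → Accurate (linearClassifier w') S → margin S w' ≤ margin S w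

end SoftMargin

end

/-! Geometry and generalization are separate. Let `S` consist of the sample points that both
classifiers label correctly. If a separator `v` of `S` had `⟨v, w*⟩ ≤ 0`, with `w*` the max-margin
SVM, then `w* + εv` would gain margin to first order in `ε`, while its norm would grow only to
second order; after normalization it would beat `w*`. So both weight vectors have positive inner
product with `w*` (`inner_pos_of_isMaxMarginSVM`), and moving along `-y w*` brings each of them to
its decision boundary.

It remains to see that `S` is large: a classifier with margin `1` on most of its own sample must be
correct on most of the other one. The ramp lies between the indicators of margin at least `1` and of
positive margin, so it is enough that the ramp sums of the two samples are close uniformly over `‖w‖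
≤ B` (`prod_pi_deviationSet_le`). Uniformity allows each output to depend on its own sample.
Exchanging entries of two i.i.d. samples preserves their law, which reduces the bound to random
signs on fixed points (`prod_pi_le_of_card_swapWhere_le`). There, contraction bounds the mean of the
supremum and bounded differences bound its fluctuation. -/

namespace SoftMargin

/-! ### Random signs: moments and concentration -/

/-- The sign `±1` encoded by a Boolean. -/
def boolSign (b : Bool) : ℝ := if b then 1 else -1

@[simp] lemma boolSign_true : boolSign true = 1 := rfl

@[simp] lemma boolSign_false : boolSign false = -1 := rfl

lemma abs_boolSign (b : Bool) : |boolSign b| = 1 := by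
  cases b <;> simp

lemma sum_boolVec_succ {n : ℕ} (f : (Fin (n + 1) → Bool) → ℝ) :
    ∑ σ, f σ = ∑ σ : Fin n → Bool,
      (f (Fin.cons (α := fun _ => Bool) true σ) + f (Fin.cons (α := fun _ => Bool) false σ)) := by
  rw [← (Fin.consEquiv (fun _ : Fin (n + 1) => Bool)).sum_comp, Fintype.sum_prod_type]
  simp [Fin.consEquiv, Finset.sum_add_distrib]

/-- The second moment of a shifted Rademacher sum of vectors. -/
lemma sum_norm_sq_rademacher {E : Type*} [NormedAddCommGroup E] [InnerProductSpace ℝ E] :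
    ∀ {n : ℕ} (u : Fin n → E) (v : E),
      ∑ σ : Fin n → Bool, ‖v + ∑ i, boolSign (σ i) • u i‖ ^ 2
        = 2 ^ n * (‖v‖ ^ 2 + ∑ i, ‖u i‖ ^ 2)
  | 0, u, v => by simp
  | n + 1, u, v => by
    have h : ∀ σ : Fin n → Bool,
        ‖v + (u 0 + ∑ i, boolSign (σ i) • u i.succ)‖ ^ 2
          + ‖v + (-u 0 + ∑ i, boolSign (σ i) • u i.succ)‖ ^ 2
        = 2 * ‖v + ∑ i, boolSign (σ i) • u i.succ‖ ^ 2 + 2 * ‖u 0‖ ^ 2 := by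
      intro σ
      have := parallelogram_law_with_norm ℝ (v + ∑ i, boolSign (σ i) • u i.succ) (u 0)
      rw [show v + (u 0 + ∑ i, boolSign (σ i) • u i.succ)
          = v + ∑ i, boolSign (σ i) • u i.succ + u 0 by abel,
        show v + (-u 0 + ∑ i, boolSign (σ i) • u i.succ)
          = v + ∑ i, boolSign (σ i) • u i.succ - u 0 by abel]
      nlinarith
    rw [sum_boolVec_succ]
    simp only [Fin.sum_univ_succ, Fin.cons_zero, Fin.cons_succ, boolSign_true, boolSign_false,
      one_smul, neg_smul, h]
    rw [Finset.sum_add_distrib, ← Finset.mul_sum, sum_norm_sq_rademacher (fun i => u i.succ) v]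
    simp
    ring

/-- The first moment of a Rademacher sum of `n` vectors of norm at most `R`. -/
lemma sum_norm_rademacher_le {E : Type*} [NormedAddCommGroup E] [InnerProductSpace ℝ E]
    {n : ℕ} (u : Fin n → E) {R : ℝ} (hR : 0 ≤ R) (hu : ∀ i, ‖u i‖ ≤ R) :
    ∑ σ : Fin n → Bool, ‖∑ i, boolSign (σ i) • u i‖ ≤ 2 ^ n * (R * √n) := by
  have h2 : ∑ σ : Fin n → Bool, ‖∑ i, boolSign (σ i) • u i‖ ^ 2 ≤ 2 ^ n * (n * R ^ 2) := by
    have := sum_norm_sq_rademacher u 0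
    simp only [zero_add, norm_zero] at this
    rw [this]
    gcongr
    calc (0 : ℝ) ^ 2 + ∑ i, ‖u i‖ ^ 2 = ∑ i, ‖u i‖ ^ 2 := by simp
      _ ≤ ∑ _i : Fin n, R ^ 2 :=
          Finset.sum_le_sum fun i _ => pow_le_pow_left₀ (norm_nonneg _) (hu i) 2
      _ = n * R ^ 2 := by simp
  -- Cauchy–Schwarz over the sign patterns passes from the second moment to the first.
  have hcs := sq_sum_le_card_mul_sum_sq (s := (Finset.univ : Finset (Fin n → Bool)))
    (f := fun σ => ‖∑ i, boolSign (σ i) • u i‖)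
  simp only [Finset.card_univ, Fintype.card_pi, Fintype.card_bool, Finset.prod_const,
    Fintype.card_fin, Nat.cast_pow, Nat.cast_ofNat] at hcs
  refine abs_le_of_sq_le_sq' ?_ (by positivity) |>.2
  calc _ ≤ _ := hcs
    _ ≤ 2 ^ n * (2 ^ n * (n * R ^ 2)) := by gcongr
    _ = (2 ^ n * (R * √n)) ^ 2 := by
      rw [mul_pow, mul_pow, Real.sq_sqrt (Nat.cast_nonneg n)]; ring

/-- The exponential moment of a function of independent signs with bounded differences. -/
lemma sum_exp_le_of_boundedDifferences (l : ℝ) :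
    ∀ {n : ℕ} (f : (Fin n → Bool) → ℝ),
      (∀ σ τ i, (∀ j, j ≠ i → σ j = τ j) → |f σ - f τ| ≤ 2) →
      ∑ σ, Real.exp (l * f σ)
        ≤ 2 ^ n * Real.exp (l * ((∑ σ, f σ) / 2 ^ n) + n * (l ^ 2 / 2))
  | 0, f, _ => by simp
  | n + 1, f, hf => by
    -- Hoeffding's lemma for one sign: factoring out the midpoint leaves `cosh (l * (u - v) / 2)`,
    -- and `cosh x ≤ exp (x ^ 2 / 2)`.
    have hstep : ∀ u v : ℝ, |u - v| ≤ 2 → Real.exp (l * u) + Real.exp (l * v)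
        ≤ 2 * Real.exp (l ^ 2 / 2) * Real.exp (l * ((u + v) / 2)) := by
      intro u v huv
      have h1 : Real.exp (l * u) + Real.exp (l * v)
          = 2 * Real.cosh (l * (u - v) / 2) * Real.exp (l * ((u + v) / 2)) := by
        rw [Real.cosh_eq, mul_div_cancel₀ _ (two_ne_zero' ℝ), add_mul, ← Real.exp_add,
          ← Real.exp_add]
        congr 2 <;> ring
      rw [h1]
      gcongr
      refine (Real.cosh_le_exp_half_sq _).trans (Real.exp_le_exp.2 ?_)
      have h2 : (u - v) ^ 2 ≤ 2 ^ 2 := sq_le_sq' (abs_le.1 huv).1 (abs_le.1 huv).2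
      nlinarith [mul_le_mul_of_nonneg_left h2 (sq_nonneg l)]
    -- Averaging over the first sign keeps both the mean and the bounded differences, so the
    -- induction applies to `g`.
    set g : (Fin n → Bool) → ℝ := fun σ =>
      (f (Fin.cons (α := fun _ => Bool) true σ) + f (Fin.cons (α := fun _ => Bool) false σ)) / 2
      with hg
    have hcons : ∀ (b : Bool) (σ τ : Fin n → Bool) i, (∀ j, j ≠ i → σ j = τ j) →
        |f (Fin.cons (α := fun _ => Bool) b σ) - f (Fin.cons (α := fun _ => Bool) b τ)| ≤ 2 := by
      intro b σ τ i h
      refine hf _ _ i.succ fun j => ?_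
      refine Fin.cases (by simp) (fun j hj => ?_) j
      simpa using h j (by simpa using hj)
    have ih := sum_exp_le_of_boundedDifferences l g (by
      intro σ τ i h
      have h1 := abs_le.1 (hcons true σ τ i h)
      have h2 := abs_le.1 (hcons false σ τ i h)
      rw [abs_le]
      simp only [hg]
      constructor <;> linarith [h1.1, h1.2, h2.1, h2.2])
    have hmean : (∑ σ, f σ) / 2 ^ (n + 1) = (∑ σ, g σ) / 2 ^ n := by
      rw [sum_boolVec_succ, hg, ← Finset.sum_div, pow_succ]
      field_simp
    calc ∑ σ, Real.exp (l * f σ)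
        ≤ ∑ σ, 2 * Real.exp (l ^ 2 / 2) * Real.exp (l * g σ) := by
          rw [sum_boolVec_succ]
          refine Finset.sum_le_sum fun σ _ => hstep _ _ (hf _ _ 0 fun j => ?_)
          refine Fin.cases (by simp) (fun j _ => by simp) j
      _ ≤ 2 * Real.exp (l ^ 2 / 2)
          * (2 ^ n * Real.exp (l * ((∑ σ, g σ) / 2 ^ n) + n * (l ^ 2 / 2))) := by
          rw [← Finset.mul_sum]
          gcongr
      _ = _ := by
          rw [hmean, Nat.cast_succ, add_mul, one_mul, ← add_assoc, Real.exp_add _ (l ^ 2 / 2),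
            pow_succ]
          ring

/-- The bounded differences inequality for independent signs. -/
lemma card_lt_le_of_boundedDifferences {n : ℕ} (hn : 1 ≤ n) (f : (Fin n → Bool) → ℝ)
    (hf : ∀ σ τ i, (∀ j, j ≠ i → σ j = τ j) → |f σ - f τ| ≤ 2) {m s : ℝ} (hs : 0 ≤ s)
    (hm : ∑ σ, f σ ≤ 2 ^ n * m) :
    (((Finset.univ.filter fun σ => m + s < f σ).card : ℕ) : ℝ)
      ≤ 2 ^ n * Real.exp (-(s ^ 2 / (2 * n))) := by
  have hn0 : (0 : ℝ) < n := by exact_mod_cast hn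
  -- Chernoff bound with `l = s / n`, the minimizer of `-l * s + n * l ^ 2 / 2`.
  have hl : 0 ≤ s / n := by positivity
  have h1 := sum_exp_le_of_boundedDifferences (s / n) f hf
  have h2 : (((Finset.univ.filter fun σ => m + s < f σ).card : ℕ) : ℝ)
      * Real.exp (s / n * (m + s)) ≤ ∑ σ, Real.exp (s / n * f σ) := by
    rw [← nsmul_eq_mul]
    refine (Finset.card_nsmul_le_sum _ (fun σ => Real.exp (s / n * f σ)) _ ?_).trans
      (Finset.sum_le_sum_of_subset_of_nonneg (Finset.subset_univ _)
        fun _ _ _ => (Real.exp_pos _).le)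
    intro σ hσ
    have := (Finset.mem_filter.1 hσ).2
    gcongr
  have h3 : (∑ σ, f σ) / 2 ^ n ≤ m := by
    rw [div_le_iff₀ (by positivity)]; linarith
  have h4 : (2 : ℝ) ^ n * Real.exp (s / n * ((∑ σ, f σ) / 2 ^ n) + n * ((s / n) ^ 2 / 2))
      ≤ 2 ^ n * Real.exp (-(s ^ 2 / (2 * n))) * Real.exp (s / n * (m + s)) := by
    have : -(s ^ 2 / (2 * n)) + s / n * (m + s) = s / n * m + n * ((s / n) ^ 2 / 2) := by
      field_simp; ring
    rw [mul_assoc, ← Real.exp_add, this]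
    gcongr
  exact le_of_mul_le_mul_right (h2.trans (h1.trans h4)) (Real.exp_pos _)

/-! ### Contraction principle -/

/-- The comparison of two signs in the contraction principle. -/
lemma iSup_add_iSup_sub_le {ι : Type*} [Nonempty ι] {G a b : ι → ℝ}
    (hab : ∀ v w, |b v - b w| ≤ |a v - a w|)
    (h1 : BddAbove (Set.range fun w => G w + a w))
    (h2 : BddAbove (Set.range fun w => G w - a w)) :
    (⨆ w, (G w + b w)) + (⨆ w, (G w - b w)) ≤ (⨆ w, (G w + a w)) + (⨆ w, (G w - a w)) := by
  refine ciSup_add_ciSup_le fun v w => ?_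
  have := (le_abs_self _).trans (hab v w)
  -- The sign of `a v - a w` decides which of `v`, `w` is tested in the supremum with `+ a`.
  rcases abs_cases (a v - a w) with h | h
  · linarith [le_ciSup h1 v, le_ciSup h2 w]
  · linarith [le_ciSup h1 w, le_ciSup h2 v]

lemma bddAbove_range_of_abs_le {ι : Type*} {f : ι → ℝ} {K : ℝ} (h : ∀ w, |f w| ≤ K) :
    BddAbove (Set.range f) :=
  ⟨K, by rintro _ ⟨w, rfl⟩; exact (le_abs_self _).trans (h w)⟩

lemma abs_sum_boolSign_mul_le {n : ℕ} {b : Fin n → ℝ} {C : ℝ} (h : ∀ i, |b i| ≤ C)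
    (σ : Fin n → Bool) : |∑ i, boolSign (σ i) * b i| ≤ n * C := by
  refine (Finset.abs_sum_le_sum_abs _ _).trans ?_
  calc _ ≤ ∑ _i : Fin n, C := Finset.sum_le_sum fun i _ => by
        rw [abs_mul, abs_boolSign, one_mul]; exact h i
    _ = _ := by simp

/-- The contraction principle for Rademacher averages. -/
lemma sum_iSup_contraction {ι : Type*} [Nonempty ι] {φ : ℝ → ℝ}
    (hφ : ∀ s t, |φ s - φ t| ≤ |s - t|) {C : ℝ} :
    ∀ {n : ℕ} (a : ι → Fin n → ℝ) (_ : ∀ w i, |a w i| ≤ C) (g : ι → ℝ) (K : ℝ)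
      (_ : ∀ w, |g w| ≤ K),
      ∑ σ : Fin n → Bool, ⨆ w, (g w + ∑ i, boolSign (σ i) * φ (a w i))
        ≤ ∑ σ : Fin n → Bool, ⨆ w, (g w + ∑ i, boolSign (σ i) * a w i)
  | 0, a, _, g, K, _ => by simp
  | n + 1, a, ha, g, K, hg => by
    -- Boundedness is carried along because an unbounded real supremum has the default value `0`.
    -- The offset `g` absorbs the first coordinate in the induction.
    have hφC : ∀ w, |φ (a w 0)| ≤ |φ 0| + C := fun w => by
      have h1 := hφ (a w 0) 0
      have h2 := ha w 0
      have h3 := abs_sub_abs_le_abs_sub (φ (a w 0)) (φ 0)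
      rw [sub_zero] at h1
      linarith
    have e1 := sum_iSup_contraction hφ (fun w i => a w (Fin.succ i)) (fun w i => ha w i.succ)
      (fun w => g w + φ (a w 0)) (K + (|φ 0| + C))
      (fun w => (abs_add_le _ _).trans (add_le_add (hg w) (hφC w)))
    have e2 := sum_iSup_contraction hφ (fun w i => a w (Fin.succ i)) (fun w i => ha w i.succ)
      (fun w => g w - φ (a w 0)) (K + (|φ 0| + C))
      (fun w => (abs_sub _ _).trans (add_le_add (hg w) (hφC w)))
    rw [sum_boolVec_succ, sum_boolVec_succ]
    simp only [Fin.sum_univ_succ, Fin.cons_zero, Fin.cons_succ, boolSign_true, boolSign_false,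
      one_mul, neg_one_mul, ← add_assoc, ← sub_eq_add_neg]
    rw [Finset.sum_add_distrib]
    refine (add_le_add e1 e2).trans ?_
    rw [← Finset.sum_add_distrib]
    refine Finset.sum_le_sum fun σ _ => ?_
    have hG : ∀ w, |g w + ∑ i, boolSign (σ i) * a w (Fin.succ i)| ≤ K + n * C := fun w =>
      (abs_add_le _ _).trans
        (add_le_add (hg w) (abs_sum_boolSign_mul_le (fun i => ha w i.succ) σ))
    have := iSup_add_iSup_sub_le
      (G := fun w => g w + ∑ i, boolSign (σ i) * a w (Fin.succ i))
      (a := fun w => a w 0) (b := fun w => φ (a w 0)) (fun v w => hφ _ _)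
      (bddAbove_range_of_abs_le fun w =>
        (abs_add_le _ _).trans (add_le_add (hG w) (ha w 0)))
      (bddAbove_range_of_abs_le fun w =>
        (abs_sub _ _).trans (add_le_add (hG w) (ha w 0)))
    simpa only [add_right_comm, add_sub_right_comm] using this

/-! ### Ramp function and Rademacher complexity -/

/-- The ramp function, which is `0` on negative numbers and `1` above `1`. -/
noncomputable def ramp (t : ℝ) : ℝ := max 0 (min 1 t)

lemma ramp_nonneg (t : ℝ) : 0 ≤ ramp t := le_max_left _ _

lemma ramp_le_one (t : ℝ) : ramp t ≤ 1 := max_le zero_le_one (min_le_left _ _)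

lemma ramp_of_one_le {t : ℝ} (h : 1 ≤ t) : ramp t = 1 := by simp [ramp, h]

lemma ramp_of_nonpos {t : ℝ} (h : t ≤ 0) : ramp t = 0 := by
  simp [ramp, h]

lemma continuous_ramp : Continuous ramp := by unfold ramp; fun_prop

lemma abs_ramp_sub_ramp_le (s t : ℝ) : |ramp s - ramp t| ≤ |s - t| := by
  unfold ramp
  refine (abs_max_sub_max_le_max _ _ _ _).trans (max_le (by simp) ?_)
  exact (abs_min_sub_min_le_max _ _ _ _).trans (max_le (by simp) le_rfl)

/-- The Rademacher complexity of a `1`-Lipschitz function of the linear functionals of norm at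
most `B`, on `n` points of norm at most `R`. -/
lemma sum_iSup_rademacher_le {E : Type*} [NormedAddCommGroup E] [InnerProductSpace ℝ E]
    {φ : ℝ → ℝ} (hφ : ∀ s t, |φ s - φ t| ≤ |s - t|)
    {n : ℕ} (u : Fin n → E) {B R : ℝ} (hB : 0 ≤ B) (hR : 0 ≤ R) (hu : ∀ i, ‖u i‖ ≤ R) :
    ∑ σ : Fin n → Bool, ⨆ w : Metric.closedBall (0 : E) B,
        ∑ i, boolSign (σ i) * φ (inner ℝ (w : E) (u i)) ≤ 2 ^ n * (B * R * √n) := by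
  have : Nonempty (Metric.closedBall (0 : E) B) := ⟨⟨0, by simpa using hB⟩⟩
  have h1 := sum_iSup_contraction hφ (C := B * R)
    (fun (w : Metric.closedBall (0 : E) B) i => inner ℝ (w : E) (u i))
    (fun w i => (abs_real_inner_le_norm _ _).trans
      (mul_le_mul (mem_closedBall_zero_iff.1 w.2) (hu i) (norm_nonneg _) hB))
    (fun _ => 0) 0 (by simp)
  simp only [zero_add] at h1
  refine h1.trans ?_
  calc _ ≤ ∑ σ : Fin n → Bool, B * ‖∑ i, boolSign (σ i) • u i‖ := by
        refine Finset.sum_le_sum fun σ _ => ciSup_le fun w => ?_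
        have : ∑ i, boolSign (σ i) * inner ℝ (w : E) (u i)
            = inner ℝ (w : E) (∑ i, boolSign (σ i) • u i) := by
          simp [inner_sum, real_inner_smul_right]
        rw [this]
        exact (real_inner_le_norm _ _).trans
          (mul_le_mul_of_nonneg_right (mem_closedBall_zero_iff.1 w.2) (norm_nonneg _))
    _ ≤ B * (2 ^ n * (R * √n)) := by
        rw [← Finset.mul_sum]
        exact mul_le_mul_of_nonneg_left (sum_norm_rademacher_le u hR hu) hB
    _ = _ := by ring

/-- The largest signed difference between the ramps of two point sequences, over the linear
functionals of norm at most `B`. -/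
noncomputable def rampDeviation {E : Type*} [NormedAddCommGroup E] [InnerProductSpace ℝ E]
    {n : ℕ} (B : ℝ) (u v : Fin n → E) (σ : Fin n → Bool) : ℝ :=
  ⨆ w : Metric.closedBall (0 : E) B,
    ∑ i, boolSign (σ i) * (ramp (inner ℝ (w : E) (u i)) - ramp (inner ℝ (w : E) (v i)))

section

variable {E : Type*} [NormedAddCommGroup E] [InnerProductSpace ℝ E] {n : ℕ}

lemma abs_ramp_sub_ramp_le_one (s t : ℝ) : |ramp s - ramp t| ≤ 1 := by
  rw [abs_le]
  constructor <;> linarith [ramp_nonneg s, ramp_nonneg t, ramp_le_one s, ramp_le_one t]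

lemma bddAbove_rampDeviation (B : ℝ) (u v : Fin n → E) (σ : Fin n → Bool) :
    BddAbove (Set.range fun w : Metric.closedBall (0 : E) B =>
      ∑ i, boolSign (σ i) * (ramp (inner ℝ (w : E) (u i)) - ramp (inner ℝ (w : E) (v i)))) :=
  bddAbove_range_of_abs_le fun _ =>
    abs_sum_boolSign_mul_le (fun _ => abs_ramp_sub_ramp_le_one _ _) σ

lemma rampDeviation_le_add_two {B : ℝ} (hB : 0 ≤ B) (u v : Fin n → E) (σ τ : Fin n → Bool)
    (i : Fin n) (h : ∀ j, j ≠ i → σ j = τ j) :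
    rampDeviation B u v σ ≤ rampDeviation B u v τ + 2 := by
  have : Nonempty (Metric.closedBall (0 : E) B) := ⟨⟨0, by simpa using hB⟩⟩
  refine ciSup_le fun w => ?_
  refine le_trans ?_ (add_le_add (le_ciSup (bddAbove_rampDeviation B u v τ) w) le_rfl)
  rw [← sub_le_iff_le_add', ← Finset.sum_sub_distrib, Finset.sum_eq_single i]
  · rw [← sub_mul]
    refine (le_abs_self _).trans ?_
    rw [abs_mul]
    have h1 : |boolSign (σ i) - boolSign (τ i)| ≤ 2 := by
      cases σ i <;> cases τ i <;> norm_num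
    have h2 := abs_ramp_sub_ramp_le_one (inner ℝ (w : E) (u i)) (inner ℝ (w : E) (v i))
    calc _ ≤ (2 : ℝ) * 1 := mul_le_mul h1 h2 (abs_nonneg _) zero_le_two
      _ = 2 := by norm_num
  · intro j _ hj
    rw [h j hj, sub_self]
  · simp

/-- The supremum of a sum is at most the sum of the suprema. Contraction applies to each, with
`ramp` and with `-ramp`, hence the factor `2`. -/
lemma sum_rampDeviation_le {B R : ℝ} (hB : 0 ≤ B) (hR : 0 ≤ R) (u v : Fin n → E)
    (hu : ∀ i, ‖u i‖ ≤ R) (hv : ∀ i, ‖v i‖ ≤ R) :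
    ∑ σ, rampDeviation B u v σ ≤ 2 ^ n * (2 * B * R * √n) := by
  have : Nonempty (Metric.closedBall (0 : E) B) := ⟨⟨0, by simpa using hB⟩⟩
  have h1 := sum_iSup_rademacher_le abs_ramp_sub_ramp_le u hB hR hu
  have h2 := sum_iSup_rademacher_le (φ := fun t => -ramp t) (fun s t => by
    rw [neg_sub_neg, abs_sub_comm]; exact abs_ramp_sub_ramp_le s t) v hB hR hv
  have habs : ∀ t, |ramp t| ≤ 1 := fun t => by
    rw [abs_of_nonneg (ramp_nonneg t)]; exact ramp_le_one t
  calc _ ≤ ∑ σ : Fin n → Bool,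
        ((⨆ w : Metric.closedBall (0 : E) B, ∑ i, boolSign (σ i) * ramp (inner ℝ (w : E) (u i)))
        + ⨆ w : Metric.closedBall (0 : E) B,
          ∑ i, boolSign (σ i) * -ramp (inner ℝ (w : E) (v i))) := by
        refine Finset.sum_le_sum fun σ _ => ciSup_le fun w => ?_
        refine le_trans (le_of_eq ?_) (add_le_add
          (le_ciSup (bddAbove_range_of_abs_le fun w : Metric.closedBall (0 : E) B =>
            abs_sum_boolSign_mul_le (fun i => habs (inner ℝ (w : E) (u i))) σ) w)
          (le_ciSup (bddAbove_range_of_abs_le fun w : Metric.closedBall (0 : E) B =>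
            abs_sum_boolSign_mul_le (fun i => (abs_neg _).trans_le
              (habs (inner ℝ (w : E) (v i)))) σ) w))
        rw [← Finset.sum_add_distrib]
        exact Finset.sum_congr rfl fun i _ => by ring
    _ ≤ 2 ^ n * (B * R * √n) + 2 ^ n * (B * R * √n) := by
        rw [Finset.sum_add_distrib]
        exact add_le_add h1 h2
    _ = _ := by ring

/-- For most sign patterns, the signed ramp deviation is small. -/
lemma card_lt_rampDeviation_le (hn : 1 ≤ n) {B R : ℝ} (hB : 0 ≤ B) (hR : 0 ≤ R)
    (u v : Fin n → E) (hu : ∀ i, ‖u i‖ ≤ R) (hv : ∀ i, ‖v i‖ ≤ R) {s : ℝ} (hs : 0 ≤ s) :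
    (((Finset.univ.filter fun σ => 2 * B * R * √n + s < rampDeviation B u v σ).card : ℕ) : ℝ)
      ≤ 2 ^ n * Real.exp (-(s ^ 2 / (2 * n))) := by
  refine card_lt_le_of_boundedDifferences hn _ (fun σ τ i h => ?_) hs
    (sum_rampDeviation_le hB hR u v hu hv)
  have h1 := rampDeviation_le_add_two hB u v σ τ i h
  have h2 := rampDeviation_le_add_two hB u v τ σ i fun j hj => (h j hj).symm
  rw [abs_le]
  constructor <;> linarith

end

/-! ### Symmetrization by exchanging sample entries -/

section

variable {X : Type*} {n : ℕ}

/-- Exchange the entries of two sequences at the indices where `σ` is `false`. -/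
def swapWhere (σ : Fin n → Bool) (z : (Fin n → X) × (Fin n → X)) : (Fin n → X) × (Fin n → X) :=
  (fun i => if σ i then z.1 i else z.2 i, fun i => if σ i then z.2 i else z.1 i)

/-- Regrouped as a sequence of pairs, the map acts on each pair by the identity or the swap, and
both preserve `D.prod D`. -/
lemma measurePreserving_swapWhere [MeasurableSpace X] (D : Measure X) [IsProbabilityMeasure D]
    (σ : Fin n → Bool) :
    MeasurePreserving (swapWhere σ)
      ((Measure.pi fun _ : Fin n => D).prod (Measure.pi fun _ : Fin n => D))
      ((Measure.pi fun _ : Fin n => D).prod (Measure.pi fun _ : Fin n => D)) := by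
  have he := measurePreserving_arrowProdEquivProdArrow X X (Fin n) (fun _ => D) (fun _ => D)
  have hf : MeasurePreserving
      (fun (z : Fin n → X × X) i => (if σ i then id else Prod.swap : X × X → X × X) (z i))
      (Measure.pi fun _ => D.prod D) (Measure.pi fun _ => D.prod D) := by
    refine measurePreserving_pi _ _ fun i => ?_
    split_ifs
    · exact MeasurePreserving.id _
    · exact Measure.measurePreserving_swap
  have := he.comp (hf.comp (he.symm _))
  convert this using 1
  funext z
  refine Prod.ext (funext fun i => ?_) (funext fun i => ?_) <;>
  · simp only [swapWhere, Function.comp, MeasurableEquiv.arrowProdEquivProdArrow,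
      Equiv.arrowProdEquivProdArrow]
    cases h : σ i <;> simp [h]

open Classical in
/-- Symmetrization of two independent samples: the probability of an event is at most the largest
fraction of the sign patterns for which the swapped samples belong to it. -/
lemma prod_pi_le_of_card_swapWhere_le [MeasurableSpace X] (D : Measure X)
    [IsProbabilityMeasure D] {A : Set ((Fin n → X) × (Fin n → X))} (hA : MeasurableSet A) {δ : ℝ}
    (h : ∀ᵐ z ∂((Measure.pi fun _ : Fin n => D).prod (Measure.pi fun _ : Fin n => D)),
      (((Finset.univ.filter fun σ => swapWhere σ z ∈ A).card : ℕ) : ℝ) ≤ 2 ^ n * δ) :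
    ((Measure.pi fun _ : Fin n => D).prod (Measure.pi fun _ : Fin n => D)) A
      ≤ ENNReal.ofReal δ := by
  set P := (Measure.pi fun _ : Fin n => D).prod (Measure.pi fun _ : Fin n => D)
  -- Every preimage of `A` has the measure of `A`, so summing over `σ` and exchanging sum and
  -- integral turns `P A` into the mean fraction of patterns.
  have h1 : ∀ σ : Fin n → Bool, ∫⁻ z, (swapWhere σ ⁻¹' A).indicator 1 z ∂P = P A := fun σ => by
    have hs := measurePreserving_swapWhere (n := n) D σ
    rw [lintegral_indicator_one (hs.measurable hA), hs.measure_preimage hA.nullMeasurableSet]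
  have h2 : (2 : ENNReal) ^ n * P A ≤ 2 ^ n * ENNReal.ofReal δ := by
    calc (2 : ENNReal) ^ n * P A
        = ∑ σ : Fin n → Bool, ∫⁻ z, (swapWhere σ ⁻¹' A).indicator 1 z ∂P := by
          simp [h1]
      _ = ∫⁻ z, ∑ σ : Fin n → Bool, (swapWhere σ ⁻¹' A).indicator 1 z ∂P := by
          rw [lintegral_finsetSum]
          exact fun σ _ => measurable_one.indicator
            ((measurePreserving_swapWhere D σ).measurable hA)
      _ ≤ ∫⁻ _, 2 ^ n * ENNReal.ofReal δ ∂P := by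
          refine lintegral_mono_ae (h.mono fun z hz => ?_)
          have h3 : ∑ σ : Fin n → Bool, (swapWhere σ ⁻¹' A).indicator (1 : (Fin n → X) × (Fin n → X) → ENNReal) z
              = ((Finset.univ.filter fun σ => swapWhere σ z ∈ A).card : ENNReal) := by
            rw [Finset.card_filter]
            simp [Set.indicator_apply]
          rw [h3]
          calc (((Finset.univ.filter fun σ => swapWhere σ z ∈ A).card : ℕ) : ENNReal)
              = ENNReal.ofReal
                (((Finset.univ.filter fun σ => swapWhere σ z ∈ A).card : ℕ) : ℝ) := by simp
            _ ≤ ENNReal.ofReal (2 ^ n * δ) := ENNReal.ofReal_le_ofReal hz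
            _ = _ := by
              rw [ENNReal.ofReal_mul (by positivity), ENNReal.ofReal_pow (by norm_num)]
              simp
      _ = _ := by simp
  rwa [ENNReal.mul_le_mul_iff_right (by simp) (by simp)] at h2

end

/-! ### Geometry of the max-margin SVM -/

lemma sign_eq_label_iff {y t : ℝ} (hy : y = 1 ∨ y = -1) : Real.sign t = y ↔ 0 < y * t := by
  rcases lt_trichotomy t 0 with h | h | h
  · rw [Real.sign_of_neg h]
    rcases hy with rfl | rfl
    · norm_num; exact h.le
    · simpa using h
  · rcases hy with rfl | rfl <;> simp [h]
  · rw [Real.sign_of_pos h]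
    rcases hy with rfl | rfl
    · simpa using h
    · norm_num; exact h.le

variable {d : ℕ}

lemma accurate_iff {S : Finset (Example d)} (hS : ∀ p ∈ S, p.2 = 1 ∨ p.2 = -1)
    {w : EuclideanSpace ℝ (Fin d)} :
    Accurate (linearClassifier w) S ↔ ∀ p ∈ S, 0 < p.2 * inner ℝ w p.1 :=
  forall₂_congr fun p hp => sign_eq_label_iff (hS p hp)

lemma margin_le {S : Finset (Example d)} (w : EuclideanSpace ℝ (Fin d)) {p : Example d}
    (hp : p ∈ S) : margin S w ≤ p.2 * inner ℝ w p.1 :=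
  ciInf_le (Set.finite_range fun p : S => p.1.2 * inner ℝ w p.1.1).bddBelow ⟨p, hp⟩

lemma le_margin {S : Finset (Example d)} (hne : S.Nonempty) {w : EuclideanSpace ℝ (Fin d)}
    {m : ℝ} (h : ∀ p ∈ S, m ≤ p.2 * inner ℝ w p.1) : m ≤ margin S w :=
  have := hne.to_subtype
  le_ciInf fun p => h p.1 p.2

lemma margin_pos {S : Finset (Example d)} (hne : S.Nonempty) {w : EuclideanSpace ℝ (Fin d)}
    (h : ∀ p ∈ S, 0 < p.2 * inner ℝ w p.1) : 0 < margin S w := by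
  have := hne.to_subtype
  obtain ⟨p, hp⟩ := exists_eq_ciInf_of_finite (f := fun p : S => p.1.2 * inner ℝ w p.1.1)
  unfold margin
  rw [← hp]
  exact h p.1 p.2

lemma continuous_margin {S : Finset (Example d)} (hne : S.Nonempty) :
    Continuous (margin S) := by
  have := hne.to_subtype
  have h : margin S = fun w => Finset.univ.inf' Finset.univ_nonempty
      fun p : S => p.1.2 * inner ℝ w p.1.1 := by
    funext w
    rw [Finset.inf'_univ_eq_ciInf]
    rfl
  rw [h]
  exact Continuous.finset_inf'_apply _ fun p _ => by fun_prop

/-- A linearly separable finite set has a max-margin SVM. -/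
lemma exists_isMaxMarginSVM {S : Finset (Example d)} (hne : S.Nonempty)
    (hS : ∀ p ∈ S, p.2 = 1 ∨ p.2 = -1) {w : EuclideanSpace ℝ (Fin d)}
    (hw : ∀ p ∈ S, 0 < p.2 * inner ℝ w p.1) : ∃ wS, IsMaxMarginSVM S wS := by
  have hw0 : w ≠ 0 := by
    rintro rfl
    obtain ⟨p, hp⟩ := hne
    simpa using hw p hp
  have hw1 : 0 < ‖w‖⁻¹ := inv_pos.2 (norm_pos_iff.2 hw0)
  have hmem : ‖w‖⁻¹ • w ∈ Metric.sphere (0 : EuclideanSpace ℝ (Fin d)) 1 := by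
    simp [norm_smul, hw0]
  -- The maximum is taken over the whole compact sphere; it is accurate because it does at least as
  -- well as the normalized `w`, whose margin is positive.
  obtain ⟨v, hv, hmax⟩ := (isCompact_sphere (0 : EuclideanSpace ℝ (Fin d)) 1).exists_isMaxOn
    ⟨_, hmem⟩ (continuous_margin hne).continuousOn
  refine ⟨v, by simpa using hv, (accurate_iff hS).2 fun p hp => ?_, fun w' hw' _ =>
    hmax (by simpa using hw')⟩
  refine lt_of_lt_of_le (lt_of_lt_of_le (margin_pos hne fun q hq => ?_) (hmax hmem))
    (margin_le v hp)
  rw [real_inner_smul_left, mul_left_comm]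
  exact mul_pos hw1 (hw q hq)

/-- Every separator of `S` has positive inner product with the max-margin SVM of `S`. -/
lemma inner_pos_of_isMaxMarginSVM {S : Finset (Example d)} (hne : S.Nonempty)
    (hS : ∀ p ∈ S, p.2 = 1 ∨ p.2 = -1) {v w : EuclideanSpace ℝ (Fin d)}
    (hw : IsMaxMarginSVM S w) (hv : ∀ p ∈ S, 0 < p.2 * inner ℝ v p.1) :
    0 < inner ℝ v w := by
  by_contra! hneg
  obtain ⟨hw1, hacc, hmax⟩ := hw
  have hg := margin_pos hne ((accurate_iff hS).1 hacc)
  have hm := margin_pos hne hv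
  set γ := margin S w
  set m := margin S v
  -- Optimality will force `2 * m ≤ ε * γ * ‖v‖ ^ 2`, whereas this `ε` makes the right side less
  -- than `m`.
  set ε := m / (γ * (‖v‖ ^ 2 + 1)) with hε
  have hε0 : 0 < ε := by positivity
  set u := w + ε • v with hu
  have hup : ∀ p ∈ S, γ + ε * m ≤ p.2 * inner ℝ u p.1 := fun p hp => by
    rw [hu, inner_add_left, real_inner_smul_left, mul_add, mul_left_comm]
    exact add_le_add (margin_le w hp) (mul_le_mul_of_nonneg_left (margin_le v hp) hε0.le)
  have hc : 0 < γ + ε * m := by positivity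
  have hu0 : u ≠ 0 := by
    intro h
    obtain ⟨p, hp⟩ := hne
    have := hup p hp
    rw [h] at this
    simp at this
    linarith
  have hun : 0 < ‖u‖ := norm_pos_iff.2 hu0
  have hup' : ∀ p ∈ S, (γ + ε * m) / ‖u‖ ≤ p.2 * inner ℝ (‖u‖⁻¹ • u) p.1 := fun p hp => by
    rw [real_inner_smul_left, mul_left_comm, div_eq_inv_mul]
    exact mul_le_mul_of_nonneg_left (hup p hp) (inv_nonneg.2 hun.le)
  have h1 : (γ + ε * m) / ‖u‖ ≤ γ :=
    (le_margin hne hup').trans (hmax _ (by simp [norm_smul, hu0])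
      ((accurate_iff hS).2 fun p hp => (div_pos hc hun).trans_le (hup' p hp)))
  rw [div_le_iff₀ hun] at h1
  have h2 : ‖u‖ ^ 2 ≤ 1 + ε ^ 2 * ‖v‖ ^ 2 := by
    rw [hu, norm_add_sq_real, hw1, norm_smul, real_inner_smul_right, real_inner_comm, mul_pow,
      Real.norm_eq_abs, sq_abs]
    nlinarith
  have h3 : (γ + ε * m) ^ 2 ≤ γ ^ 2 * (1 + ε ^ 2 * ‖v‖ ^ 2) := by
    refine (pow_le_pow_left₀ hc.le h1 2).trans ?_
    rw [mul_pow]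
    gcongr
  have h4 : ε * γ * (‖v‖ ^ 2 + 1) = m := by
    rw [hε]; field_simp
  have h5 : ε * γ * (2 * m) ≤ ε * γ * (ε * γ * ‖v‖ ^ 2) := by
    nlinarith [sq_nonneg (ε * m)]
  have h6 := le_of_mul_le_mul_left h5 (mul_pos hε0 hg)
  nlinarith [mul_pos hε0 hg]

/-- The margin direction is adversarial for every separator. -/
lemma isAdversarialDirection_of_inner_pos {w v x : EuclideanSpace ℝ (Fin d)} {y : ℝ}
    (hy : y = 1 ∨ y = -1) (hx : linearClassifier w x = y) (hv : 0 < inner ℝ w v) :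
    IsAdversarialDirection (linearClassifier w) (-(y • v)) x y := by
  have hyx := (sign_eq_label_iff hy).1 hx
  -- This step length lands exactly on the decision boundary, which counts as misclassified since
  -- `sgn 0 = 0`.
  refine ⟨hx, y * inner ℝ w x / inner ℝ w v, div_pos hyx hv, ?_⟩
  unfold linearClassifier
  rw [Ne, sign_eq_label_iff hy, not_lt, inner_add_right, real_inner_smul_right, inner_neg_right,
    real_inner_smul_right]
  have hy2 : y * y = 1 := by rcases hy with rfl | rfl <;> norm_num
  refine le_of_eq ?_
  field_simp
  linear_combination (-(y * inner ℝ w x)) * hy2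

/-! ### Uniform closeness of two samples -/

/-- The pairs of samples whose ramp losses differ in total by more than `t` for some linear
classifier of norm at most `B`. -/
def deviationSet (d n : ℕ) (B t : ℝ) : Set ((Fin n → Example d) × (Fin n → Example d)) :=
  {z | ∃ w : EuclideanSpace ℝ (Fin d), ‖w‖ ≤ B ∧
    t < ∑ i, (ramp ((z.1 i).2 * inner ℝ w (z.1 i).1) - ramp ((z.2 i).2 * inner ℝ w (z.2 i).1))}

/-- Openness gives measurability although the union over `w` is uncountable. -/
lemma isOpen_deviationSet (d n : ℕ) (B t : ℝ) : IsOpen (deviationSet d n B t) := by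
  have : deviationSet d n B t = ⋃ w : Metric.closedBall (0 : EuclideanSpace ℝ (Fin d)) B,
      {z | t < ∑ i, (ramp ((z.1 i).2 * inner ℝ (w : EuclideanSpace ℝ (Fin d)) (z.1 i).1)
        - ramp ((z.2 i).2 * inner ℝ (w : EuclideanSpace ℝ (Fin d)) (z.2 i).1))} := by
    ext z
    simp [deviationSet]
  rw [this]
  refine isOpen_iUnion fun w => isOpen_lt continuous_const ?_
  have := continuous_ramp
  fun_prop

lemma ae_prod_pi_of_ae {X : Type*} [MeasurableSpace X] {n : ℕ} (D : Measure X)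
    [IsProbabilityMeasure D] {P : X → Prop} (h : ∀ᵐ p ∂D, P p) :
    ∀ᵐ z ∂((Measure.pi fun _ : Fin n => D).prod (Measure.pi fun _ : Fin n => D)),
      (∀ i, P (z.1 i)) ∧ ∀ i, P (z.2 i) := by
  have h1 : ∀ᵐ z ∂(Measure.pi fun _ : Fin n => D), ∀ i, P (z i) :=
    ae_all_iff.2 fun i => (Measure.quasiMeasurePreserving_eval (μ := fun _ : Fin n => D) i).ae h
  exact (Measure.quasiMeasurePreserving_fst.ae h1).and (Measure.quasiMeasurePreserving_snd.ae h1)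

/-- With high probability, the total ramp losses of two independent samples are uniformly close. -/
lemma prod_pi_deviationSet_le {n : ℕ} (hn : 1 ≤ n) (D : Measure (Example d))
    [IsProbabilityMeasure D] {B R : ℝ} (hB : 0 ≤ B) (hR0 : 0 ≤ R)
    (hlabel : ∀ᵐ p ∂D, p.2 = 1 ∨ p.2 = -1) (hR : ∀ᵐ p ∂D, ‖p.1‖ ≤ R) :
    ((Measure.pi fun _ : Fin n => D).prod (Measure.pi fun _ : Fin n => D))
      (deviationSet d n B (2 * B * R * √n + 4 * √(n * Real.log n)))
        ≤ ENNReal.ofReal (1 / (n : ℝ) ^ 2) := by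
  classical
  have hn0 : (0 : ℝ) < n := by exact_mod_cast hn
  have hlog : 0 ≤ Real.log n := Real.log_natCast_nonneg n
  refine prod_pi_le_of_card_swapWhere_le D (isOpen_deviationSet d n B _).measurableSet ?_
  have hnorm : ∀ᵐ p ∂D, ‖p.2 • p.1‖ ≤ R := by
    filter_upwards [hlabel, hR] with p hp hpR
    rw [norm_smul]
    rcases hp with h | h <;> simpa [h] using hpR
  filter_upwards [ae_prod_pi_of_ae D hnorm] with z hz
  have hcard := card_lt_rampDeviation_le hn hB hR0 (fun i => (z.1 i).2 • (z.1 i).1)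
    (fun i => (z.2 i).2 • (z.2 i).1) hz.1 hz.2 (s := 4 * √(n * Real.log n)) (by positivity)
  -- The exponent is `-8 * log n`; `-2 * log n` already suffices.
  have hexp : Real.exp (-((4 * √(n * Real.log n)) ^ 2 / (2 * n))) ≤ 1 / (n : ℝ) ^ 2 := by
    rw [mul_pow, Real.sq_sqrt (by positivity)]
    calc _ ≤ Real.exp (-(2 * Real.log n)) := by
          refine Real.exp_le_exp.2 (neg_le_neg ?_)
          rw [le_div_iff₀ (by positivity)]
          nlinarith [mul_nonneg hn0.le hlog]
      _ = _ := by
          rw [Real.exp_neg, two_mul, Real.exp_add, Real.exp_log hn0, one_div, sq]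
  refine le_trans ?_ (hcard.trans (mul_le_mul_of_nonneg_left hexp (by positivity)))
  rw [Nat.cast_le]
  refine Finset.card_le_card fun σ hσ => ?_
  simp only [Finset.mem_filter, Finset.mem_univ, true_and] at hσ ⊢
  -- Exchanging the `i`-th entries negates the `i`-th ramp difference, so the swapped sum is a
  -- signed sum.
  obtain ⟨w, hw, hlt⟩ := hσ
  refine lt_of_lt_of_le hlt (le_trans (le_of_eq (Finset.sum_congr rfl fun i _ => ?_))
    (le_ciSup (bddAbove_rampDeviation B _ _ σ) ⟨w, mem_closedBall_zero_iff.2 hw⟩))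
  simp only [swapWhere, real_inner_smul_right]
  cases h : σ i <;> simp

lemma ncard_eq_sum_indicator {n : ℕ} (P : Fin n → Prop) [DecidablePred P] :
    (Set.ncard {i | P i} : ℝ) = ∑ i, if P i then (1 : ℝ) else 0 := by
  rw [Finset.sum_boole, ← Set.ncard_coe_finset]
  simp

/-- Outside the deviation set, a classifier with large margin on most of the first sample is
correct on most of the second. -/
lemma ncard_pos_ge_of_notMem_deviationSet {n : ℕ} {B t : ℝ}
    {z : (Fin n → Example d) × (Fin n → Example d)} (hz : z ∉ deviationSet d n B t)
    {w : EuclideanSpace ℝ (Fin d)} (hw : ‖w‖ ≤ B) :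
    (Set.ncard {i | 1 ≤ (z.1 i).2 * inner ℝ w (z.1 i).1} : ℝ) - t
      ≤ Set.ncard {i | 0 < (z.2 i).2 * inner ℝ w (z.2 i).1} := by
  classical
  have h : ∑ i, (ramp ((z.1 i).2 * inner ℝ w (z.1 i).1)
      - ramp ((z.2 i).2 * inner ℝ w (z.2 i).1)) ≤ t := not_lt.1 fun h => hz ⟨w, hw, h⟩
  rw [Finset.sum_sub_distrib] at h
  have h1 : (Set.ncard {i | 1 ≤ (z.1 i).2 * inner ℝ w (z.1 i).1} : ℝ)
      ≤ ∑ i, ramp ((z.1 i).2 * inner ℝ w (z.1 i).1) := by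
    rw [ncard_eq_sum_indicator]
    refine Finset.sum_le_sum fun i _ => ?_
    split_ifs with hi
    · rw [ramp_of_one_le hi]
    · exact ramp_nonneg _
  have h2 : ∑ i, ramp ((z.2 i).2 * inner ℝ w (z.2 i).1)
      ≤ Set.ncard {i | 0 < (z.2 i).2 * inner ℝ w (z.2 i).1} := by
    rw [ncard_eq_sum_indicator]
    refine Finset.sum_le_sum fun i _ => ?_
    split_ifs with hi
    · exact ramp_le_one _
    · rw [ramp_of_nonpos (not_lt.1 hi)]
  linarith

lemma ncard_add_ncard_le_ncard_and {n : ℕ} (P Q : Fin n → Prop) :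
    (Set.ncard {i | P i} : ℝ) + Set.ncard {i | Q i} - n ≤ Set.ncard {i | P i ∧ Q i} := by
  classical
  simp only [ncard_eq_sum_indicator]
  have : (n : ℝ) = ∑ _i : Fin n, (1 : ℝ) := by simp
  rw [this, ← Finset.sum_add_distrib, ← Finset.sum_sub_distrib]
  refine Finset.sum_le_sum fun i _ => ?_
  by_cases hP : P i <;> by_cases hQ : Q i <;> simp [hP, hQ]

/-! ### Common adversarial direction and conclusion -/

/-- The deterministic part: two classifiers with uniformly close ramp losses share the max-margin
direction of their commonly correct points as an adversarial direction. -/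
lemma exists_common_adversarial_direction {n : ℕ} (hd : 0 < d) {B t ρ : ℝ}
    {T : Fin 2 → Fin n → Example d} {w : Fin 2 → EuclideanSpace ℝ (Fin d)}
    (hlabel : ∀ j i, (T j i).2 = 1 ∨ (T j i).2 = -1) (hB : ∀ j, ‖w j‖ ≤ B)
    (hmargin : ∀ j, (1 - ρ) * (n : ℝ) ≤ Set.ncard {i | 1 ≤ (T j i).2 * inner ℝ (w j) (T j i).1})
    (hdev : ∀ j k, j ≠ k → (T j, T k) ∉ deviationSet d n B t) :
    ∃ S : Finset (Example d), (∀ p ∈ S, ∃ j i, T j i = p) ∧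
      ∃ wS, IsMaxMarginSVM S wS ∧ ∀ j,
        (1 - 2 * ρ) * (n : ℝ) - t ≤ Set.ncard {i | T j i ∈ S} ∧
        ∀ p ∈ S, IsAdversarialDirection (linearClassifier (w j)) (-(p.2 • wS)) p.1 p.2 := by
  classical
  set S : Finset (Example d) := (Finset.univ.image fun q : Fin 2 × Fin n => T q.1 q.2).filter
    fun p => ∀ k, linearClassifier (w k) p.1 = p.2 with hSdef
  have hST : ∀ p ∈ S, ∃ j i, T j i = p := fun p hp => by
    obtain ⟨q, -, hq⟩ := Finset.mem_image.1 (Finset.mem_filter.1 hp).1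
    exact ⟨q.1, q.2, hq⟩
  have hS : ∀ p ∈ S, p.2 = 1 ∨ p.2 = -1 := fun p hp => by
    obtain ⟨j, i, rfl⟩ := hST p hp
    exact hlabel j i
  have hcorrect : ∀ k, ∀ p ∈ S, 0 < p.2 * inner ℝ (w k) p.1 := fun k p hp =>
    (sign_eq_label_iff (hS p hp)).1 ((Finset.mem_filter.1 hp).2 k)
  -- A classifier loses nothing on its own sample and at most `t` on the other one.
  have hcorr : ∀ j k, (1 - ρ) * (n : ℝ) - (if j = k then 0 else t)
      ≤ Set.ncard {i | 0 < (T j i).2 * inner ℝ (w k) (T j i).1} := by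
    intro j k
    split_ifs with hjk
    · subst hjk
      rw [sub_zero]
      refine (hmargin j).trans ?_
      have hsub : {i | 1 ≤ (T j i).2 * inner ℝ (w j) (T j i).1}
          ⊆ {i | 0 < (T j i).2 * inner ℝ (w j) (T j i).1} :=
        Set.ofPred_subset_ofPred.2 fun i hi => lt_of_lt_of_le one_pos hi
      exact_mod_cast Set.ncard_le_ncard hsub (Set.toFinite _)
    · exact (sub_le_sub_right (hmargin k) t).trans
        (ncard_pos_ge_of_notMem_deviationSet (hdev k j (Ne.symm hjk)) (hB k))
  have hcount : ∀ j, (1 - 2 * ρ) * (n : ℝ) - t ≤ Set.ncard {i | T j i ∈ S} := fun j => by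
    have hset : {i | T j i ∈ S} = {i | 0 < (T j i).2 * inner ℝ (w 0) (T j i).1 ∧
        0 < (T j i).2 * inner ℝ (w 1) (T j i).1} := by
      ext i
      have hmem : T j i ∈ Finset.univ.image fun q : Fin 2 × Fin n => T q.1 q.2 :=
        Finset.mem_image.2 ⟨(j, i), Finset.mem_univ _, rfl⟩
      rw [Set.mem_ofPred_eq, hSdef, Finset.mem_filter, Fin.forall_fin_two]
      simp only [linearClassifier, sign_eq_label_iff (hlabel j i), hmem, true_and,
        Set.mem_ofPred_eq]
    rw [hset]
    -- Inclusion–exclusion: `2 * (1 - ρ) * n - t - n = (1 - 2 * ρ) * n - t`.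
    refine le_trans ?_ (ncard_add_ncard_le_ncard_and _ _)
    have h0 := hcorr j 0
    have h1 := hcorr j 1
    fin_cases j <;> simp at h0 h1 ⊢ <;> linarith
  refine ⟨S, hST, ?_⟩
  rcases S.eq_empty_or_nonempty with hE | hne
  -- For empty `S` every margin is the default infimum `0`, so any unit vector works; one exists
  -- because `0 < d`.
  · refine ⟨EuclideanSpace.single ⟨0, hd⟩ 1, ⟨by simp, by simp [hE, Accurate], ?_⟩,
      fun j => ⟨hcount j, by simp [hE]⟩⟩
    intro w' _ _
    rw [hE]
    simp [margin]
  · obtain ⟨wS, hwS⟩ := exists_isMaxMarginSVM hne hS (hcorrect 0)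
    exact ⟨wS, hwS, fun j => ⟨hcount j, fun p hp =>
      isAdversarialDirection_of_inner_pos (hS p hp) ((Finset.mem_filter.1 hp).2 j)
        (inner_pos_of_isMaxMarginSVM hne hS hwS (hcorrect j))⟩⟩

end SoftMargin

theorem mainTheorem1 {d n : ℕ} (hn : 1 ≤ n)
    {Ω : Type*} [MeasurableSpace Ω] (μ : Measure Ω) [IsProbabilityMeasure μ]
    (D : Measure (SoftMargin.Example d)) [IsProbabilityMeasure D]
    (R B ρ : ℝ) (hρ0 : 0 ≤ ρ) (hρ1 : ρ < 1)
    (hlabel : ∀ᵐ p ∂D, p.2 = 1 ∨ p.2 = -1)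
    (hR : ∀ᵐ p ∂D, ‖p.1‖ ≤ R)
    -- `T j ω i` is the `i`-th example of the `j`-th training sample, which has law `Dⁿ`
    (T : Fin 2 → Ω → Fin n → SoftMargin.Example d)
    (hT : ∀ j, Measurable (T j))
    (hlaw : ∀ j, μ.map (T j) = Measure.pi (fun _ : Fin n => D))
    -- `w j ω` is the (possibly randomized) output of the `j`-th training procedure
    (w : Fin 2 → Ω → EuclideanSpace ℝ (Fin d))
    (hw : ∀ j, Measurable (w j))
    (hindep : IndepFun (fun ω => (T 0 ω, w 0 ω)) (fun ω => (T 1 ω, w 1 ω)) μ)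
    (hB : ∀ j, ∀ᵐ ω ∂μ, ‖w j ω‖ ≤ B)
    (hmargin : ∀ j, ∀ᵐ ω ∂μ,
      (1 - ρ) * (n : ℝ) ≤
        (Set.ncard {i : Fin n | 1 ≤ (T j ω i).2 * inner ℝ (w j ω) (T j ω i).1} : ℝ)) :
    ∃ G : Set Ω, MeasurableSet G ∧ 1 - 4 / (n : ℝ) ^ 2 ≤ μ.real G ∧
      ∀ ω ∈ G, ∃ S : Finset (SoftMargin.Example d),
        (∀ p ∈ S, ∃ j i, T j ω i = p) ∧
        ∃ wS : EuclideanSpace ℝ (Fin d), SoftMargin.IsMaxMarginSVM S wS ∧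
          ∀ j : Fin 2,
            (1 - 2 * ρ) * (n : ℝ) - 2 * B * R * Real.sqrt n - 4 * Real.sqrt (n * Real.log n) ≤
              (Set.ncard {i : Fin n | T j ω i ∈ S} : ℝ) ∧
            ∀ p ∈ S, SoftMargin.IsAdversarialDirection
              (SoftMargin.linearClassifier (w j ω)) (-(p.2 • wS)) p.1 p.2 := by

  have hn0 : (0 : ℝ) < n := by exact_mod_cast hn
  have hB0 : 0 ≤ B := by
    obtain ⟨ω, hω⟩ := (hB 0).exists
    exact (norm_nonneg _).trans hω
  have hR0 : 0 ≤ R := by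
    obtain ⟨p, hp⟩ := hR.exists
    exact (norm_nonneg _).trans hp
  -- In dimension `0` no point has margin `1`, which contradicts `0 < (1 - ρ) * n`.
  have hd : 0 < d := by
    obtain ⟨ω, hω⟩ := (hmargin 0).exists
    rw [Nat.pos_iff_ne_zero]
    rintro rfl
    have hempty : {i : Fin n | 1 ≤ (T 0 ω i).2 * inner ℝ (w 0 ω) (T 0 ω i).1} = ∅ := by
      ext i
      simp [Subsingleton.elim (w 0 ω) 0]
    rw [hempty] at hω
    simp only [Set.ncard_empty, Nat.cast_zero] at hω
    nlinarith [mul_pos (sub_pos.2 hρ1) hn0]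
  set t : ℝ := 2 * B * R * √n + 4 * √(n * Real.log n)
  have hTindep : ∀ j k, j ≠ k → IndepFun (T j) (T k) μ := by
    have h01 : IndepFun (T 0) (T 1) μ := hindep.comp measurable_fst measurable_fst
    intro j k hjk
    fin_cases j <;> fin_cases k <;> first | exact absurd rfl hjk | exact h01 | exact h01.symm
  have hdev : ∀ j k, j ≠ k → μ {ω | (T j ω, T k ω) ∈ SoftMargin.deviationSet d n B t}
      ≤ ENNReal.ofReal (1 / (n : ℝ) ^ 2) := by
    intro j k hjk
    have hmap := (indepFun_iff_map_prod_eq_prod_map_map (hT j).aemeasurable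
      (hT k).aemeasurable).1 (hTindep j k hjk)
    rw [hlaw, hlaw] at hmap
    have := SoftMargin.prod_pi_deviationSet_le hn D hB0 hR0 hlabel hR
    rwa [← hmap, Measure.map_apply ((hT j).prodMk (hT k))
      (SoftMargin.isOpen_deviationSet d n B t).measurableSet] at this
  have hlab : ∀ j, ∀ᵐ ω ∂μ, ∀ i, (T j ω i).2 = 1 ∨ (T j ω i).2 = -1 := by
    intro j
    have h1 : ∀ᵐ z ∂(μ.map (T j)), ∀ i, (z i).2 = 1 ∨ (z i).2 = -1 := by
      rw [hlaw]
      exact ae_all_iff.2 fun i =>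
        (Measure.quasiMeasurePreserving_eval (μ := fun _ : Fin n => D) i).ae hlabel
    exact ae_of_ae_map (hT j).aemeasurable h1
  have hgood : ∀ᵐ ω ∂μ, ∀ j, (∀ i, (T j ω i).2 = 1 ∨ (T j ω i).2 = -1) ∧ ‖w j ω‖ ≤ B ∧
      (1 - ρ) * (n : ℝ) ≤
        (Set.ncard {i : Fin n | 1 ≤ (T j ω i).2 * inner ℝ (w j ω) (T j ω i).1} : ℝ) :=
    ae_all_iff.2 fun j => (hlab j).and ((hB j).and (hmargin j))
  -- The exceptional null set need not be measurable, so it is enlarged to a measurable one.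
  obtain ⟨N, hN, hNmeas, hN0⟩ := exists_measurable_superset_of_null (ae_iff.1 hgood)
  -- The deviation is one-sided, so both orders of the samples are excluded, at a total cost of at
  -- most `2 / n ^ 2`.
  let A : Fin 2 → Fin 2 → Set Ω :=
    fun j k => {ω | (T j ω, T k ω) ∈ SoftMargin.deviationSet d n B t}
  have hAmeas : ∀ j k, MeasurableSet (A j k) := fun j k =>
    ((hT j).prodMk (hT k)) (SoftMargin.isOpen_deviationSet d n B t).measurableSet
  have hbad : MeasurableSet (N ∪ (A 0 1 ∪ A 1 0)) :=
    hNmeas.union ((hAmeas 0 1).union (hAmeas 1 0))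
  refine ⟨(N ∪ (A 0 1 ∪ A 1 0))ᶜ, hbad.compl, ?_, fun ω hω => ?_⟩
  · rw [probReal_compl_eq_one_sub hbad]
    have hreal : ∀ j k, j ≠ k → μ.real (A j k) ≤ 1 / (n : ℝ) ^ 2 := fun j k hjk =>
      ENNReal.toReal_le_of_le_ofReal (by positivity) (hdev j k hjk)
    have hNr : μ.real N = 0 := by simp [Measure.real, hN0]
    have h1 := measureReal_union_le (μ := μ) N (A 0 1 ∪ A 1 0)
    have h2 := measureReal_union_le (μ := μ) (A 0 1) (A 1 0)
    have h3 := hreal 0 1 (by decide)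
    have h4 := hreal 1 0 (by decide)
    have h5 : 4 / (n : ℝ) ^ 2 = 4 * (1 / (n : ℝ) ^ 2) := by ring
    have h6 : 0 ≤ 1 / (n : ℝ) ^ 2 := by positivity
    linarith
  · simp only [Set.mem_compl_iff, Set.mem_union, not_or] at hω
    obtain ⟨hωN, h01, h10⟩ := hω
    have hg := not_not.1 fun h => hωN (hN h)
    have hdevω : ∀ j k, j ≠ k → (T j ω, T k ω) ∉ SoftMargin.deviationSet d n B t := by
      intro j k hjk
      fin_cases j <;> fin_cases k <;> first | exact absurd rfl hjk | exact h01 | exact h10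
    obtain ⟨S, hST, wS, hwS, h⟩ := SoftMargin.exists_common_adversarial_direction
      (T := fun j => T j ω) (w := fun j => w j ω) hd (fun j => (hg j).1)
      (fun j => (hg j).2.1) (fun j => (hg j).2.2) hdevω
    refine ⟨S, hST, wS, hwS, fun j => ⟨?_, (h j).2⟩⟩
    rw [sub_sub]
    exact (h j).1
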